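/- Let $m\ge 0$, let $0=k_0<k_1<\dots<k_m$ be integers and let $\varphi_0=0,\varphi_1,\dots,\varphi_m$ be real numbers. Put $\chi_i(\varphi)=\cos(k_i\varphi+\varphi_i)$ and let $\mathrm{Wr}$ denote the Wronskian with respect to $\varphi$ (the empty Wronskian being $1$). In polar coordinates $x=(r\cos\varphi,r\sin\varphi)$ on $\mathbb R^2$, $r>0$, let $$V_k(x)=-\frac{2}{r^2}\,\frac{\partial^2}{\partial\varphi^2}\log\bigl|\mathrm{Wr}[\chi_0,\dots,\chi_m](\varphi)\bigr| ,$$ which is defined on the set $R$ of all $x\neq 0$ whose polar angle $\varphi$ satisfies $\mathrm{Wr}[\chi_0,\dots,\chi_m](\varphi)\ne 0$. Let $\mathcal L=-\Delta_2+V_k$, and let $\Omega\subseteq R$ be open. The Hadamard coefficients of $\mathcal L$ on $\Omega$ are functions $U_\nu\in C^\infty(\Omega\times\Omega)$, $\nu\ge 0$, with $U_0\equiv 1$ and $$(x-\xi,\partial_x)\,U_\nu(x,\xi)+\nu\,U_\nu(x,\xi)=-\mathcal L[U_{\nu-1}(\cdot,\xi)](x),\qquad \nu=1,2,\dots$$ Then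 such functions exist on $\Omega\times\Omega$ and are given, for $x=(r\cos\varphi,r\sin\varphi)$ and $\xi=(\varrho\cos\phi,\varrho\sin\phi)$ in $\Omega$ with $r,\varrho>0$, by $$U_\nu(x,\xi)=\frac{(-2)^\nu}{(r\varrho)^\nu}\sum_{i=0}^m c_i\,\Psi_i(\varphi)\,\Psi_i(\phi)\,T^{(\nu)}_{k_i}(\cos(\varphi-\phi)),\qquad \nu\ge 0,$$ where $$\Psi_i=\frac{\mathrm{Wr}[\chi_0,\dots,\chi_{i-1},\chi_{i+1},\dots,\chi_m]}{\mathrm{Wr}[\chi_0,\dots,\chi_m]},\qquad c_i=\prod_{j\ne i}(k_i^2-k_j^2),$$ and $T_N^{(\nu)}$ is the $\nu$-th derivative of the $N$-th Chebyshev polynomial $T_N(z)=\cos(N\arccos z)$. Any Hadamard coefficients of $\mathcal L$ on $\Omega$ coincide with these at all $(x,\xi)$ for which the segment $[\xi,x]$ lies in $\Omega$ (hence everywhere if $\Omega$ is convex). In particular $U_\nu\equiv 0$ for all $\nu>k_m$. -/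

import Mathlib

open scoped ContDiff

namespace Huygens

/-- The Wronskian `det (f_j^{(i)}(t))_{i,j}` of functions `f_0, …, f_{n-1}`
(equal to `1` for the empty family). -/
noncomputable def wronskian {n : ℕ} (f : Fin n → ℝ → ℝ) (t : ℝ) : ℝ :=
  (Matrix.of fun i j : Fin n => iteratedDeriv (i : ℕ) (f j) t).det

/-- The functions `χ_i(φ) = cos (k_i φ + φ_i)`. -/
noncomputable def chi {n : ℕ} (k : Fin n → ℤ) (phase : Fin n → ℝ) (i : Fin n) (φ : ℝ) : ℝ :=
  Real.cos ((k i : ℝ) * φ + phase i)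

/-- The Wronskian of all the functions `χ_0, …, χ_m`. -/
noncomputable def chiWronskian {m : ℕ} (k : Fin (m + 1) → ℤ) (phase : Fin (m + 1) → ℝ)
    (φ : ℝ) : ℝ :=
  wronskian (chi k phase) φ

/-- `Ψ_i`: the Wronskian of the `χ_j`, `j ≠ i`, divided by the Wronskian of all the `χ_j`. -/
noncomputable def Psi {m : ℕ} (k : Fin (m + 1) → ℤ) (phase : Fin (m + 1) → ℝ)
    (i : Fin (m + 1)) (φ : ℝ) : ℝ :=
  wronskian (fun j : Fin m => chi k phase (i.succAbove j)) φ / chiWronskian k phase φ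

/-- `c_i = ∏_{j ≠ i} (k_i² - k_j²)`. -/
noncomputable def coeff {m : ℕ} (k : Fin (m + 1) → ℤ) (i : Fin (m + 1)) : ℝ :=
  ∏ j ∈ Finset.univ.erase i, ((k i : ℝ) ^ 2 - (k j : ℝ) ^ 2)

/-- The `ν`-th derivative of the Chebyshev polynomial `T_N`, evaluated at `z`. -/
noncomputable def chebyshevDeriv (N : ℤ) (ν : ℕ) (z : ℝ) : ℝ :=
  (Polynomial.derivative^[ν] (Polynomial.Chebyshev.T ℝ N)).eval z

/-- The point of the Euclidean plane with polar coordinates `(r, φ)`. -/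
noncomputable def polarPoint (r φ : ℝ) : EuclideanSpace ℝ (Fin 2) :=
  !₂[r * Real.cos φ, r * Real.sin φ]

/-- A polar angle of a point of the plane (in `(-π, π]`). -/
noncomputable def polarAngle (x : EuclideanSpace ℝ (Fin 2)) : ℝ :=
  Complex.arg ⟨x 0, x 1⟩

/-- The potential `V_k = -(2 / r²) ∂²/∂φ² log Wr[χ_0, …, χ_m]`. As `Real.log` is `log |·|`,
a negative Wronskian is allowed; by `2π`-periodicity the choice of the polar angle is immaterial,
see `potential_polarPoint`. -/
noncomputable def potential {m : ℕ} (k : Fin (m + 1) → ℤ) (phase : Fin (m + 1) → ℝ)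
    (x : EuclideanSpace ℝ (Fin 2)) : ℝ :=
  -(2 / ‖x‖ ^ 2) *
    iteratedDeriv 2 (fun φ => Real.log (chiWronskian k phase φ)) (polarAngle x)

/-- The punctured plane without the lines through the origin on which the Wronskian vanishes:
the set on which `potential k phase` is defined by its formula. -/
def regularSet {m : ℕ} (k : Fin (m + 1) → ℤ) (phase : Fin (m + 1) → ℝ) :
    Set (EuclideanSpace ℝ (Fin 2)) :=
  {x | x ≠ 0 ∧ chiWronskian k phase (polarAngle x) ≠ 0}

/-- The Schrödinger operator `ℒ = -Δ + V` on `ℝⁿ`. -/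
noncomputable def schrodinger {n : ℕ} (V : EuclideanSpace ℝ (Fin n) → ℝ)
    (f : EuclideanSpace ℝ (Fin n) → ℝ) (x : EuclideanSpace ℝ (Fin n)) : ℝ :=
  -(Laplacian.laplacian f x) + V x * f x

/-- `U_0, U_1, …` are Hadamard coefficients of `-Δ + V` on `Ω`: they are smooth on `Ω × Ω`
(diagonal included), `U_0 ≡ 1`, and they satisfy the transport equations
`(x - ξ, ∂_x) U_ν + ν U_ν = -ℒ U_{ν-1}` for `ν ≥ 1`. -/
structure IsHadamardCoefficients {n : ℕ} (V : EuclideanSpace ℝ (Fin n) → ℝ)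
    (Ω : Set (EuclideanSpace ℝ (Fin n)))
    (U : ℕ → EuclideanSpace ℝ (Fin n) → EuclideanSpace ℝ (Fin n) → ℝ) : Prop where
  smooth : ∀ ν, ContDiffOn ℝ ∞
    (fun p : EuclideanSpace ℝ (Fin n) × EuclideanSpace ℝ (Fin n) => U ν p.1 p.2) (Ω ×ˢ Ω)
  zero_eq_one : ∀ x ∈ Ω, ∀ ξ ∈ Ω, U 0 x ξ = 1
  transport : ∀ ν : ℕ, ∀ x ∈ Ω, ∀ ξ ∈ Ω,
    fderiv ℝ (fun y => U (ν + 1) y ξ) x (x - ξ) + ((ν : ℝ) + 1) * U (ν + 1) x ξ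
      = -(schrodinger V (fun y => U ν y ξ) x)

theorem wronskian_add_two_pi {m : ℕ} (k : Fin (m + 1) → ℤ) (phase : Fin (m + 1) → ℝ)
    (n : ℤ) (φ : ℝ) :
    chiWronskian k phase (φ + 2 * Real.pi * n) = chiWronskian k phase φ := by
  unfold chiWronskian wronskian
  congr 1
  ext i j
  simp only [Matrix.of_apply]
  have h : (fun t => chi k phase j (t + 2 * Real.pi * n)) = chi k phase j := by
    funext t
    unfold chi
    rw [← Real.cos_add_int_mul_two_pi ((k j : ℝ) * t + phase j) (k j * n)]
    congr 1
    push_cast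
    ring
  have h2 := congrFun (iteratedDeriv_comp_add_const (i : ℕ) (chi k phase j)
    (2 * Real.pi * n)) φ
  rw [h] at h2
  exact h2.symm

theorem polarAngle_polarPoint {r : ℝ} (hr : 0 < r) (φ : ℝ) :
    ∃ n : ℤ, polarAngle (polarPoint r φ) = φ + 2 * Real.pi * n := by
  refine ⟨⌊(Real.pi - φ) / (2 * Real.pi)⌋, ?_⟩
  rw [← Complex.arg_mul_cos_add_sin_mul_I_sub hr φ]
  have h : (⟨polarPoint r φ 0, polarPoint r φ 1⟩ : ℂ)
      = r * (Complex.cos φ + Complex.sin φ * Complex.I) := by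
    apply Complex.ext <;>
      simp [polarPoint, ← Complex.ofReal_cos, ← Complex.ofReal_sin]
  unfold polarAngle
  rw [h]
  ring

theorem norm_polarPoint {r : ℝ} (hr : 0 < r) (φ : ℝ) : ‖polarPoint r φ‖ = r := by
  rw [EuclideanSpace.norm_eq, Real.sqrt_eq_iff_mul_self_eq (by positivity) hr.le]
  simp only [polarPoint, Fin.sum_univ_two, Real.norm_eq_abs, sq_abs]
  simp
  nlinarith [Real.sin_sq_add_cos_sq φ]

/-- The formula for the potential holds for every choice of the polar angle. -/
theorem potential_polarPoint {m : ℕ} (k : Fin (m + 1) → ℤ) (phase : Fin (m + 1) → ℝ)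
    {r : ℝ} (hr : 0 < r) (φ : ℝ) :
    potential k phase (polarPoint r φ) =
      -(2 / r ^ 2) * iteratedDeriv 2 (fun t => Real.log (chiWronskian k phase t)) φ := by
  obtain ⟨n, hn⟩ := polarAngle_polarPoint hr φ
  unfold potential
  rw [norm_polarPoint hr, hn]
  congr 1
  have h2 := congrFun (iteratedDeriv_comp_add_const 2
    (fun t => Real.log (chiWronskian k phase t)) (2 * Real.pi * n)) φ
  simp only [wronskian_add_two_pi] at h2
  exact h2.symm

theorem polarPoint_mem_regularSet {m : ℕ} (k : Fin (m + 1) → ℤ) (phase : Fin (m + 1) → ℝ)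
    {r : ℝ} (hr : 0 < r) (φ : ℝ) :
    polarPoint r φ ∈ regularSet k phase ↔ chiWronskian k phase φ ≠ 0 := by
  obtain ⟨n, hn⟩ := polarAngle_polarPoint hr φ
  have h0 : polarPoint r φ ≠ 0 := by
    rw [← norm_pos_iff, norm_polarPoint hr]
    exact hr
  simp [regularSet, hn, wronskian_add_two_pi, h0]

end Huygens

namespace Huygens

/-! Up to sign, the `Ψ_i(t)` form the last column of the inverse Wronskian matrix, so `∑ Ψ_i
χ_i^{(j)} = δ_{jm}` for `j ≤ m` (`sum_signedPsi_mul_iteratedDeriv_chi`). Differentiating this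
duality twice and using `χ_i'' = -k_i² χ_i` yields `-Ψ_i'' - 2 (log Wr)'' Ψ_i = k_i² Ψ_i`
(`deriv_deriv_signedPsi`).

By homogeneity in `r`, the transport equation reduces to an identity in the angles
(`angularSum_transport`). It holds term by term: the eigenvalue equation absorbs the potential, and
the rest is the `ν`-fold derivative of the Chebyshev equation.

The normalisation `U_0 = 1`, that is `∑ c_i Ψ_i(s) Ψ_i(t) cos (k_i (s - t)) = 1`, is where the `c_i`
enter. As `χ_0 = 1`, the monic operator of order `m + 1` annihilating the `χ_i` factors as `Q ∂`.
Lagrange interpolation at the nodes `k_i²` identifies `Q χ_i` with `c_i Ψ_i` up to sign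
(`annihilator_chi_eq_coeff_mul_signedPsi`). Freezing the coefficients of `Q` at `t` and translating
to `s`, duality at `s` leaves only the leading coefficient `1` (`sum_coeff_mul_signedPsi_mul_cos`).

Uniqueness is integration of the transport equation along the segment from `ξ`; vanishing for `ν >
k_m` is a degree count. -/

/-! ### Derivatives, smoothness and periodicity of the `χ_i` and their Wronskians -/

theorem iteratedDeriv_chi {n : ℕ} (k : Fin n → ℤ) (phase : Fin n → ℝ) (i : Fin n) (j : ℕ) :
    iteratedDeriv j (chi k phase i) = fun t =>
      (k i : ℝ) ^ j * Real.cos ((k i : ℝ) * t + phase i + j * (Real.pi / 2)) := by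
  induction j with
  | zero => funext t; simp [chi]
  | succ j ih =>
    rw [iteratedDeriv_succ, ih]
    funext t
    have h1 : HasDerivAt (fun t => (k i : ℝ) * t + phase i + j * (Real.pi / 2)) (k i : ℝ) t := by
      simpa using (((hasDerivAt_id t).const_mul (k i : ℝ)).add_const (phase i)).add_const
        ((j : ℝ) * (Real.pi / 2))
    rw [((h1.cos).const_mul ((k i : ℝ) ^ j)).deriv]
    have : (k i : ℝ) * t + phase i + ((j + 1 : ℕ) : ℝ) * (Real.pi / 2)
        = ((k i : ℝ) * t + phase i + j * (Real.pi / 2)) + Real.pi / 2 := by push_cast; ring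
    rw [this, Real.cos_add_pi_div_two]
    ring

theorem contDiff_iteratedDeriv_chi {n : ℕ} (k : Fin n → ℤ) (phase : Fin n → ℝ) (i : Fin n)
    (j : ℕ) : ContDiff ℝ ∞ (iteratedDeriv j (chi k phase i)) := by
  rw [iteratedDeriv_chi]
  fun_prop

theorem hasDerivAt_iteratedDeriv_chi {n : ℕ} (k : Fin n → ℤ) (phase : Fin n → ℝ) (i : Fin n)
    (j : ℕ) (t : ℝ) :
    HasDerivAt (iteratedDeriv j (chi k phase i)) (iteratedDeriv (j + 1) (chi k phase i) t) t := by
  rw [iteratedDeriv_succ]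
  exact ((contDiff_iteratedDeriv_chi k phase i j).differentiable (by simp) t).hasDerivAt

theorem iteratedDeriv_add_two_chi {n : ℕ} (k : Fin n → ℤ) (phase : Fin n → ℝ) (i : Fin n)
    (j : ℕ) (t : ℝ) :
    iteratedDeriv (j + 2) (chi k phase i) t =
      -(k i : ℝ) ^ 2 * iteratedDeriv j (chi k phase i) t := by
  simp only [iteratedDeriv_chi]
  have : (k i : ℝ) * t + phase i + ((j + 2 : ℕ) : ℝ) * (Real.pi / 2)
      = ((k i : ℝ) * t + phase i + j * (Real.pi / 2)) + Real.pi := by push_cast; ring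
  rw [this, Real.cos_add_pi]
  ring

theorem contDiff_wronskian_chi {n : ℕ} (k : Fin n → ℤ) (phase : Fin n → ℝ) :
    ContDiff ℝ ∞ (wronskian (chi k phase)) := by
  unfold wronskian
  simp only [Matrix.det_apply, Matrix.of_apply]
  refine ContDiff.sum fun σ _ => ContDiff.const_smul _ (contDiff_prod fun i _ => ?_)
  exact contDiff_iteratedDeriv_chi k phase _ _

theorem wronskian_chi_add_two_pi {n : ℕ} (k : Fin n → ℤ) (phase : Fin n → ℝ) (l : ℤ) (t : ℝ) :
    wronskian (chi k phase) (t + 2 * Real.pi * l) = wronskian (chi k phase) t := by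
  unfold wronskian
  congr 1
  ext i j
  simp only [Matrix.of_apply, iteratedDeriv_chi]
  rw [← Real.cos_add_int_mul_two_pi ((k j : ℝ) * t + phase j + (i : ℕ) * (Real.pi / 2)) (k j * l)]
  congr 2
  push_cast
  ring

theorem Psi_add_two_pi {m : ℕ} (k : Fin (m + 1) → ℤ) (phase : Fin (m + 1) → ℝ)
    (i : Fin (m + 1)) (l : ℤ) (t : ℝ) :
    Psi k phase i (t + 2 * Real.pi * l) = Psi k phase i t := by
  unfold Psi chiWronskian
  rw [wronskian_chi_add_two_pi]
  congr 1
  exact wronskian_chi_add_two_pi (fun j => k (i.succAbove j)) (fun j => phase (i.succAbove j)) l t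

/-! ### Duality between the `Ψ_i` and the `χ_i` -/

/-- The functions `Ψ_i` with the signs that make them dual to the `χ_i`,
see `sum_signedPsi_mul_iteratedDeriv_chi`. -/
noncomputable def signedPsi {m : ℕ} (k : Fin (m + 1) → ℤ) (phase : Fin (m + 1) → ℝ)
    (i : Fin (m + 1)) (t : ℝ) : ℝ :=
  (-1) ^ (m + i : ℕ) * Psi k phase i t

theorem signedPsi_mul_signedPsi {m : ℕ} (k : Fin (m + 1) → ℤ) (phase : Fin (m + 1) → ℝ)
    (i : Fin (m + 1)) (s t : ℝ) :
    signedPsi k phase i s * signedPsi k phase i t = Psi k phase i s * Psi k phase i t := by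
  have h : ((-1 : ℝ) ^ (m + i : ℕ)) * (-1) ^ (m + i : ℕ) = 1 := by
    rw [← mul_pow]; simp
  unfold signedPsi
  linear_combination Psi k phase i s * Psi k phase i t * h

theorem contDiffAt_signedPsi {m : ℕ} (k : Fin (m + 1) → ℤ) (phase : Fin (m + 1) → ℝ)
    (i : Fin (m + 1)) {t : ℝ} (ht : chiWronskian k phase t ≠ 0) :
    ContDiffAt ℝ ∞ (signedPsi k phase i) t := by
  unfold signedPsi Psi
  refine contDiffAt_const.mul (ContDiffAt.div ?_ ?_ ht)
  · exact (contDiff_wronskian_chi (fun j => k (i.succAbove j))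
      (fun j => phase (i.succAbove j))).contDiffAt
  · exact (contDiff_wronskian_chi k phase).contDiffAt

theorem hasDerivAt_signedPsi {m : ℕ} {k : Fin (m + 1) → ℤ}
    {phase : Fin (m + 1) → ℝ} (i : Fin (m + 1)) {s : ℝ}
    (hs : chiWronskian k phase s ≠ 0) :
    HasDerivAt (signedPsi k phase i) (deriv (signedPsi k phase i) s) s :=
  ((contDiffAt_signedPsi k phase i hs).differentiableAt (by simp)).hasDerivAt

theorem hasDerivAt_deriv_signedPsi {m : ℕ} {k : Fin (m + 1) → ℤ}
    {phase : Fin (m + 1) → ℝ} (i : Fin (m + 1)) {s : ℝ}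
    (hs : chiWronskian k phase s ≠ 0) :
    HasDerivAt (deriv (signedPsi k phase i)) (deriv (deriv (signedPsi k phase i)) s) s := by
  have : ContDiffAt ℝ 1 (deriv (signedPsi k phase i)) s :=
    ((contDiffAt_signedPsi k phase i hs).fderiv_right (m := 1)
      (mod_cast ENat.LEInfty.out)).clm_apply contDiffAt_const
  exact (this.differentiableAt (by simp)).hasDerivAt

theorem isOpen_chiWronskian_ne_zero {m : ℕ} (k : Fin (m + 1) → ℤ) (phase : Fin (m + 1) → ℝ) :
    IsOpen {t | chiWronskian k phase t ≠ 0} :=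
  isOpen_ne_fun (contDiff_wronskian_chi k phase).continuous continuous_const

/-- The signs are those of the cofactors: `signedPsi` is the last column of the adjugate of the
Wronskian matrix divided by its determinant, so this is the last column of `A A⁻¹ = 1`. -/
theorem sum_signedPsi_mul_iteratedDeriv_chi {m : ℕ} (k : Fin (m + 1) → ℤ)
    (phase : Fin (m + 1) → ℝ) {t : ℝ} (ht : chiWronskian k phase t ≠ 0) {j : ℕ} (hj : j ≤ m) :
    ∑ i, signedPsi k phase i t * iteratedDeriv j (chi k phase i) t = if j = m then 1 else 0 := by
  set A : Matrix (Fin (m + 1)) (Fin (m + 1)) ℝ :=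
    Matrix.of fun i j : Fin (m + 1) => iteratedDeriv (i : ℕ) (chi k phase j) t with hA
  have hD : A.det = chiWronskian k phase t := rfl
  have h := congrFun (congrFun A.mul_adjugate ⟨j, by omega⟩) (Fin.last m)
  rw [Matrix.mul_apply] at h
  have h2 : ∀ i, signedPsi k phase i t = A.adjugate i (Fin.last m) / A.det := by
    intro i
    rw [Matrix.adjugate_fin_succ_eq_det_submatrix]
    unfold signedPsi Psi
    rw [hD, mul_div_assoc]
    simp only [Fin.succAbove_last, Fin.val_last]
    rfl
  calc _ = (∑ i, A ⟨j, by omega⟩ i * A.adjugate i (Fin.last m)) / A.det := by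
        rw [Finset.sum_div]
        refine Finset.sum_congr rfl fun i _ => ?_
        rw [h2 i, hA, Matrix.of_apply]
        ring
    _ = _ := by
        rw [h]
        by_cases hjm : j = m
        · have : (⟨j, by omega⟩ : Fin (m + 1)) = Fin.last m := Fin.ext hjm
          rw [this]
          simp [hjm, hD, ht]
        · have : (⟨j, by omega⟩ : Fin (m + 1)) ≠ Fin.last m := fun h => hjm (congrArg Fin.val h)
          simp [Matrix.one_apply_ne this, hjm]

theorem eq_zero_of_sum_mul_iteratedDeriv_chi {m : ℕ} (k : Fin (m + 1) → ℤ)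
    (phase : Fin (m + 1) → ℝ) {t : ℝ} (ht : chiWronskian k phase t ≠ 0) (u : Fin (m + 1) → ℝ)
    (hu : ∀ j ≤ m, ∑ i, u i * iteratedDeriv j (chi k phase i) t = 0) (i : Fin (m + 1)) :
    u i = 0 := by
  refine congrFun (Matrix.eq_zero_of_mulVec_eq_zero (M := Matrix.of fun i j : Fin (m + 1) =>
    iteratedDeriv (i : ℕ) (chi k phase j) t) ht ?_) i
  ext j
  rw [Matrix.mulVec, dotProduct]
  simpa [mul_comm] using hu j (by omega)

/-! ### Derivative of the Wronskian and the angular eigenvalue equation -/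

theorem hasDerivAt_det {n : ℕ} {A A' : Matrix (Fin n) (Fin n) ℝ} {M : ℝ → Matrix (Fin n) (Fin n) ℝ}
    {t : ℝ} (hA : M t = A) (hM : ∀ i j, HasDerivAt (fun s => M s i j) (A' i j) t) :
    HasDerivAt (fun s => (M s).det) (∑ i, (A.updateRow i (A' i)).det) t := by
  have h : HasDerivAt (fun s => ∑ σ : Equiv.Perm (Fin n), (Equiv.Perm.sign σ : ℤ) •
      ∏ i, (M s).transpose (σ i) i)
      (∑ σ : Equiv.Perm (Fin n), (Equiv.Perm.sign σ : ℤ) •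
        ∑ i, (∏ j ∈ Finset.univ.erase i, (M t).transpose (σ j) j) • A'.transpose (σ i) i) t := by
    refine HasDerivAt.fun_sum fun σ _ => ?_
    refine HasDerivAt.fun_const_smul _ ?_
    exact HasDerivAt.fun_finsetProd fun i _ => hM i (σ i)
  have e : ∀ B : Matrix (Fin n) (Fin n) ℝ, B.det = ∑ σ : Equiv.Perm (Fin n),
      (Equiv.Perm.sign σ : ℤ) • ∏ i, B.transpose (σ i) i := by
    intro B
    rw [← Matrix.det_transpose, Matrix.det_apply]
    rfl
  simp only [e]
  convert! h using 1
  rw [Finset.sum_comm]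
  refine Finset.sum_congr rfl fun σ _ => ?_
  rw [← Finset.smul_sum]
  congr 1
  refine Finset.sum_congr rfl fun i _ => ?_
  rw [← Finset.mul_prod_erase _ _ (Finset.mem_univ i), hA, smul_eq_mul, mul_comm]
  congr 1
  · refine Finset.prod_congr rfl fun j hj => ?_
    simp [Matrix.updateRow_ne (Finset.ne_of_mem_erase hj)]
  · simp

theorem hasDerivAt_chiWronskian {m : ℕ} (k : Fin (m + 1) → ℤ)
    (phase : Fin (m + 1) → ℝ) {t : ℝ} (ht : chiWronskian k phase t ≠ 0) :
    HasDerivAt (chiWronskian k phase) (chiWronskian k phase t *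
      ∑ i, signedPsi k phase i t * iteratedDeriv (m + 1) (chi k phase i) t) t := by
  set A : Matrix (Fin (m + 1)) (Fin (m + 1)) ℝ :=
    Matrix.of fun i j : Fin (m + 1) => iteratedDeriv (i : ℕ) (chi k phase j) t with hA
  have h := hasDerivAt_det (A := A) (A' := Matrix.of fun i j : Fin (m + 1) =>
      iteratedDeriv ((i : ℕ) + 1) (chi k phase j) t)
    (M := fun s => Matrix.of fun i j : Fin (m + 1) => iteratedDeriv (i : ℕ) (chi k phase j) s)
    (t := t) rfl (fun i j => hasDerivAt_iteratedDeriv_chi k phase j i t)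
  have hD : A.det = chiWronskian k phase t := rfl
  convert! h using 1
  have h2 : ∀ i, chiWronskian k phase t * signedPsi k phase i t = A.adjugate i (Fin.last m) := by
    intro i
    rw [Matrix.adjugate_fin_succ_eq_det_submatrix]
    unfold signedPsi Psi
    rw [mul_left_comm, mul_div_cancel₀ _ ht]
    simp only [Fin.succAbove_last, Fin.val_last]
    rfl
  rw [Finset.mul_sum]
  symm
  -- Differentiating any row but the last produces a repeated row. The surviving determinant is
  -- expanded along its last row by Cramer's rule.
  rw [Fin.sum_univ_castSucc, Finset.sum_eq_zero, zero_add]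
  · rw [← Matrix.cramer_transpose_apply, Matrix.cramer_eq_adjugate_mulVec,
      ← Matrix.adjugate_transpose, Matrix.mulVec, dotProduct]
    refine Finset.sum_congr rfl fun i _ => ?_
    rw [← mul_assoc, h2]
    simp
  · intro i _
    refine Matrix.det_zero_of_row_eq (i := i.castSucc) (j := i.succ) (Fin.castSucc_lt_succ).ne ?_
    rw [Matrix.updateRow_self, Matrix.updateRow_ne (Fin.castSucc_lt_succ).ne']
    ext j
    simp [hA]

theorem iteratedDeriv_two_log_chiWronskian {m : ℕ} (k : Fin (m + 1) → ℤ)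
    (phase : Fin (m + 1) → ℝ) {t : ℝ} (ht : chiWronskian k phase t ≠ 0) :
    iteratedDeriv 2 (fun s => Real.log (chiWronskian k phase s)) t =
      deriv (fun s => ∑ i, signedPsi k phase i s * iteratedDeriv (m + 1) (chi k phase i) s) t := by
  rw [iteratedDeriv_succ, iteratedDeriv_one]
  refine Filter.EventuallyEq.deriv_eq ?_
  filter_upwards [(isOpen_chiWronskian_ne_zero k phase).mem_nhds ht] with s hs
  rw [((hasDerivAt_chiWronskian k phase hs).log hs).deriv, mul_div_cancel_left₀ _ hs]

/-- Each `Ψ_i` is an eigenfunction of `-∂² - 2 (log Wr)''`. -/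
theorem deriv_deriv_signedPsi {m : ℕ} (k : Fin (m + 1) → ℤ)
    (phase : Fin (m + 1) → ℝ) {t : ℝ} (ht : chiWronskian k phase t ≠ 0) (i : Fin (m + 1)) :
    deriv (deriv (signedPsi k phase i)) t = -((k i : ℝ) ^ 2 +
      2 * iteratedDeriv 2 (fun s => Real.log (chiWronskian k phase s)) t) *
        signedPsi k phase i t := by
  rw [iteratedDeriv_two_log_chiWronskian k phase ht]
  set P : ℕ → ℝ → ℝ := fun j s => ∑ i, signedPsi k phase i s * iteratedDeriv j (chi k phase i) s
    with hP
  set Q : ℕ → ℝ → ℝ := fun j s =>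
    ∑ i, deriv (signedPsi k phase i) s * iteratedDeriv j (chi k phase i) s with hQ
  set R : ℕ → ℝ → ℝ := fun j s =>
    ∑ i, deriv (deriv (signedPsi k phase i)) s * iteratedDeriv j (chi k phase i) s with hR
  have dP : ∀ j s, chiWronskian k phase s ≠ 0 → HasDerivAt (P j) (Q j s + P (j + 1) s) s := by
    intro j s hs
    rw [hP, hQ]
    simp only [← Finset.sum_add_distrib]
    exact HasDerivAt.fun_sum fun i _ => (hasDerivAt_signedPsi i hs).mul
      (hasDerivAt_iteratedDeriv_chi k phase i j s)
  have dQ : ∀ j s, chiWronskian k phase s ≠ 0 → HasDerivAt (Q j) (R j s + Q (j + 1) s) s := by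
    intro j s hs
    rw [hR, hQ]
    simp only [← Finset.sum_add_distrib]
    exact HasDerivAt.fun_sum fun i _ => (hasDerivAt_deriv_signedPsi i hs).mul
      (hasDerivAt_iteratedDeriv_chi k phase i j s)
  have hmem : ∀ {s}, chiWronskian k phase s ≠ 0 → ∀ᶠ r in nhds s, chiWronskian k phase r ≠ 0 :=
    fun hs => (isOpen_chiWronskian_ne_zero k phase).mem_nhds hs
  -- By duality `P j` is locally constant for `j ≤ m`; differentiating this, and then the resulting
  -- relation once more, gives `PQ` and `RQ`.
  have PQ : ∀ j ≤ m, ∀ s, chiWronskian k phase s ≠ 0 → Q j s = -P (j + 1) s := by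
    intro j hj s hs
    have h1 : HasDerivAt (P j) 0 s := by
      refine (hasDerivAt_const s (if j = m then (1 : ℝ) else 0)).congr_of_eventuallyEq ?_
      filter_upwards [hmem hs] with r hr
      exact sum_signedPsi_mul_iteratedDeriv_chi k phase hr hj
    linarith [h1.unique (dP j s hs)]
  have RQ : ∀ j ≤ m, R j t = -2 * Q (j + 1) t - P (j + 2) t := by
    intro j hj
    have h1 : HasDerivAt (Q j) (-(Q (j + 1) t + P (j + 2) t)) t := by
      refine (dP (j + 1) t ht).neg.congr_of_eventuallyEq ?_
      filter_upwards [hmem ht] with r hr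
      exact PQ j hj r hr
    linarith [h1.unique (dQ j t ht)]
  have hh : deriv (P (m + 1)) t = Q (m + 1) t + P (m + 2) t := (dP (m + 1) t ht).deriv
  -- The Wronskian matrix is invertible, so it suffices to test the defect of the eigenvalue
  -- equation against every `χ_i^{(j)}`, `j ≤ m`. Since `P (m + 1)` is the logarithmic derivative of
  -- the Wronskian, its derivative compensates the only exceptional case `j = m`.
  have key := eq_zero_of_sum_mul_iteratedDeriv_chi k phase ht
    (fun i => deriv (deriv (signedPsi k phase i)) t + ((k i : ℝ) ^ 2 +
      2 * deriv (P (m + 1)) t) * signedPsi k phase i t) (fun j hj => ?_) i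
  · linarith
  · have e : ∑ i, (deriv (deriv (signedPsi k phase i)) t + ((k i : ℝ) ^ 2 +
        2 * deriv (P (m + 1)) t) * signedPsi k phase i t) * iteratedDeriv j (chi k phase i) t
        = R j t - P (j + 2) t + 2 * deriv (P (m + 1)) t * P j t := by
      simp only [hR, hP, iteratedDeriv_add_two_chi, Finset.mul_sum, ← Finset.sum_sub_distrib,
        ← Finset.sum_add_distrib]
      exact Finset.sum_congr rfl fun i _ => by ring
    rw [e, show P j t = _ from sum_signedPsi_mul_iteratedDeriv_chi k phase ht hj, RQ j hj]
    by_cases hjm : j = m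
    · subst hjm
      rw [if_pos rfl]
      linarith
    · rw [if_neg hjm, PQ (j + 1) (by omega) t ht]
      ring

/-! ### The normalisation identity behind `U_0 = 1` -/

theorem nonneg_of_strictMono {m : ℕ} {k : Fin (m + 1) → ℤ} (hk : StrictMono k) (hk0 : k 0 = 0)
    (i : Fin (m + 1)) : 0 ≤ k i :=
  hk0 ▸ hk.monotone (Fin.zero_le i)

theorem injective_sq {m : ℕ} {k : Fin (m + 1) → ℤ} (hk : StrictMono k) (hk0 : k 0 = 0) :
    Function.Injective fun i => (k i : ℝ) ^ 2 := by
  intro i j hij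
  have h := (sq_eq_sq₀ (Int.cast_nonneg (nonneg_of_strictMono hk hk0 i))
    (Int.cast_nonneg (nonneg_of_strictMono hk hk0 j))).1 hij
  exact hk.injective (Int.cast_injective h)

theorem coeff_ne_zero {m : ℕ} {k : Fin (m + 1) → ℤ} (hk : StrictMono k) (hk0 : k 0 = 0)
    (i : Fin (m + 1)) : coeff k i ≠ 0 :=
  Finset.prod_ne_zero_iff.2 fun _ hj =>
    sub_ne_zero.2 fun h => Finset.ne_of_mem_erase hj (injective_sq hk hk0 h).symm

/-- The sum is the coefficient of `X^m` in the Lagrange interpolant of `X^n` at the `m + 1` nodes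
`k_i²`, which is `X^n` itself. -/
theorem sum_pow_div_coeff {m : ℕ} {k : Fin (m + 1) → ℤ} (hk : StrictMono k) (hk0 : k 0 = 0)
    {n : ℕ} (hn : n ≤ m) :
    ∑ i, (k i : ℝ) ^ (2 * n) / coeff k i = if n = m then 1 else 0 := by
  have h := Lagrange.coeff_eq_sum (s := Finset.univ) (v := fun i => (k i : ℝ) ^ 2)
    (injective_sq hk hk0).injOn (P := Polynomial.X ^ n)
    (by rw [Polynomial.degree_X_pow, Finset.card_fin]; exact_mod_cast Nat.lt_succ_of_le hn)
  rw [Finset.card_fin, Nat.add_sub_cancel, Polynomial.coeff_X_pow] at h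
  simp only [Polynomial.eval_pow, Polynomial.eval_X, ← pow_mul] at h
  simp only [eq_comm (a := m)] at h
  exact h.symm

/-- The monic differential operator of order `m` whose composition with `∂` annihilates
all the `χ_i`. -/
theorem exists_monic_annihilator {m : ℕ} (k : Fin (m + 1) → ℤ) (phase : Fin (m + 1) → ℝ)
    (hk0 : k 0 = 0) (hphase : phase 0 = 0) {t : ℝ} (ht : chiWronskian k phase t ≠ 0) :
    ∃ q : ℕ → ℝ, q m = 1 ∧
      ∀ i, ∑ j ∈ Finset.range (m + 1), q j * iteratedDeriv (j + 1) (chi k phase i) t = 0 := by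
  set A : Matrix (Fin (m + 1)) (Fin (m + 1)) ℝ :=
    Matrix.of fun i j : Fin (m + 1) => iteratedDeriv (i : ℕ) (chi k phase j) t with hA
  have hdet : IsUnit A.det := (show A.det ≠ 0 from ht).isUnit
  set w : Fin (m + 1) → ℝ :=
    Matrix.vecMul (fun i => -iteratedDeriv (m + 1) (chi k phase i) t) A⁻¹ with hw
  have hwA : ∀ i, ∑ j : Fin (m + 1), w j * iteratedDeriv (j : ℕ) (chi k phase i) t
      = -iteratedDeriv (m + 1) (chi k phase i) t := by
    intro i
    have h : Matrix.vecMul w A = fun i => -iteratedDeriv (m + 1) (chi k phase i) t := by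
      rw [hw, Matrix.vecMul_vecMul, Matrix.nonsing_inv_mul _ hdet, Matrix.vecMul_one]
    exact congrFun h i
  -- The constant `χ_0 = 1` must be annihilated, so the operator has no term of order zero and a
  -- factor `∂` splits off.
  have hw0 : w 0 = 0 := by
    have h := hwA 0
    rw [Fin.sum_univ_succ] at h
    simpa [iteratedDeriv_chi, hk0, hphase, chi] using h
  refine ⟨fun j => if h : j < m then w ⟨j + 1, by omega⟩ else 1, by simp, fun i => ?_⟩
  have h := hwA i
  rw [Fin.sum_univ_succ, hw0, zero_mul, zero_add] at h
  rw [Finset.sum_range_succ, Finset.sum_range]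
  simp only [Fin.is_lt, lt_irrefl, dite_true, dite_false, one_mul]
  exact add_eq_zero_iff_eq_neg.2 h

theorem cos_nat_mul_pi_div_two_sub_eq_zero {j l : ℕ} (h : ¬ Even (j + l)) :
    Real.cos ((j : ℝ) * (Real.pi / 2) - l * (Real.pi / 2)) = 0 := by
  rw [Real.cos_eq_zero_iff]
  obtain ⟨n, hn⟩ := Nat.not_even_iff_odd.1 h
  refine ⟨(n : ℤ) - l, ?_⟩
  have : (j : ℝ) = 2 * n + 1 - l := by
    have h2 : (j : ℝ) + l = 2 * n + 1 := by exact_mod_cast hn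
    linarith
  rw [this]
  push_cast
  ring

section
variable {m : ℕ} {k : Fin (m + 1) → ℤ} {phase : Fin (m + 1) → ℝ} {t : ℝ} {q : ℕ → ℝ}

/-- Since `Q ∂ χ_i = 0` at `t`, the sine companion of the sum `Q χ_i` vanishes; the addition formula
then turns a phase shift by `b` into the factor `cos b`. -/
theorem sum_mul_cos_shift (hk : StrictMono k) (hk0 : k 0 = 0) (hphase : phase 0 = 0)
    (hq : ∀ i, ∑ j ∈ Finset.range (m + 1), q j * iteratedDeriv (j + 1) (chi k phase i) t = 0)
    (i : Fin (m + 1)) (b : ℝ) :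
    ∑ j ∈ Finset.range (m + 1),
        q j * ((k i : ℝ) ^ j * Real.cos ((k i : ℝ) * t + phase i + j * (Real.pi / 2) - b)) =
      (∑ j ∈ Finset.range (m + 1), q j * iteratedDeriv j (chi k phase i) t) * Real.cos b := by
  have hsin : ∑ j ∈ Finset.range (m + 1),
      q j * ((k i : ℝ) ^ j * Real.sin ((k i : ℝ) * t + phase i + j * (Real.pi / 2))) = 0 := by
    -- For `i = 0` one cannot divide by `k_i`; there the terms `j ≥ 1` carry a power of `k_0 = 0`,
    -- and `j = 0` gives `sin 0`.
    rcases eq_or_ne i 0 with rfl | hi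
    · rw [Finset.sum_range_succ']
      simp [hk0, hphase]
    · have hki : (k i : ℝ) ≠ 0 := by
        rw [Int.cast_ne_zero, ← hk0]
        exact hk.injective.ne hi
      have h := hq i
      simp only [iteratedDeriv_chi] at h
      refine (mul_eq_zero.1 (?_ : (-(k i : ℝ)) * _ = 0)).resolve_left (neg_ne_zero.2 hki)
      rw [← h, Finset.mul_sum]
      refine Finset.sum_congr rfl fun j _ => ?_
      have : (k i : ℝ) * t + phase i + ((j + 1 : ℕ) : ℝ) * (Real.pi / 2)
        = ((k i : ℝ) * t + phase i + j * (Real.pi / 2)) + Real.pi / 2 := by push_cast; ring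
      rw [this, Real.cos_add_pi_div_two]
      ring
  have h2 := congrArg (· * Real.sin b) hsin
  simp only [zero_mul, Finset.sum_mul] at h2
  symm
  rw [Finset.sum_mul, ← add_zero (Finset.sum _ _), ← h2, ← Finset.sum_add_distrib]
  refine Finset.sum_congr rfl fun j _ => ?_
  rw [Real.cos_sub, iteratedDeriv_chi]
  ring

/-- The numbers `Q χ_i / c_i` satisfy the same duality relations at `t` as `signedPsi`, and these
have only one solution. -/
theorem annihilator_chi_eq_coeff_mul_signedPsi (hk : StrictMono k) (hk0 : k 0 = 0)
    (hphase : phase 0 = 0) (ht : chiWronskian k phase t ≠ 0) (hqm : q m = 1)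
    (hq : ∀ i, ∑ j ∈ Finset.range (m + 1), q j * iteratedDeriv (j + 1) (chi k phase i) t = 0)
    (i : Fin (m + 1)) :
    ∑ j ∈ Finset.range (m + 1), q j * iteratedDeriv j (chi k phase i) t =
      coeff k i * signedPsi k phase i t := by
  set s : Fin (m + 1) → ℝ := fun i =>
    ∑ j ∈ Finset.range (m + 1), q j * iteratedDeriv j (chi k phase i) t with hs
  have hc := coeff_ne_zero hk hk0
  have key := eq_zero_of_sum_mul_iteratedDeriv_chi k phase ht
    (fun i => s i / coeff k i - signedPsi k phase i t) (fun l hl => ?_) i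
  · have h := hc i
    field_simp at key
    linarith
  · simp only [sub_mul, Finset.sum_sub_distrib]
    rw [sum_signedPsi_mul_iteratedDeriv_chi k phase ht hl, sub_eq_zero]
    have e : ∀ i, s i / coeff k i * iteratedDeriv l (chi k phase i) t =
        ∑ j ∈ Finset.range (m + 1), q j * Real.cos ((j : ℝ) * (Real.pi / 2) - l * (Real.pi / 2)) *
          ((k i : ℝ) ^ (j + l) / coeff k i) := by
      intro i
      rw [iteratedDeriv_chi]
      -- This shift cancels `k_i t + φ_i`, leaving the cosine of `(j - l) π / 2`, which is
      -- independent of `i`.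
      have h := sum_mul_cos_shift hk hk0 hphase hq i
        ((k i : ℝ) * t + phase i + l * (Real.pi / 2))
      calc _ = (s i * Real.cos ((k i : ℝ) * t + phase i + l * (Real.pi / 2))) *
            ((k i : ℝ) ^ l / coeff k i) := by ring
        _ = _ := by
            rw [← h, Finset.sum_mul]
            refine Finset.sum_congr rfl fun j _ => ?_
            rw [add_sub_add_left_eq_sub, pow_add]
            ring
    simp only [e]
    rw [Finset.sum_comm]
    simp only [← Finset.mul_sum]
    -- For odd `j + l` the cosine vanishes; for even `j + l < 2 m` the interpolation sum does.
    have z : ∀ j ≤ m, ¬ (j = m ∧ l = m) → q j *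
        Real.cos ((j : ℝ) * (Real.pi / 2) - l * (Real.pi / 2)) *
          ∑ i, (k i : ℝ) ^ (j + l) / coeff k i = 0 := by
      intro j hj hjl
      by_cases hev : Even (j + l)
      · obtain ⟨n, hn⟩ := hev
        rw [hn, ← two_mul, sum_pow_div_coeff hk hk0 (by omega), if_neg (by omega), mul_zero]
      · rw [cos_nat_mul_pi_div_two_sub_eq_zero hev, mul_zero, zero_mul]
    by_cases hlm : l = m
    · subst hlm
      rw [if_pos rfl, Finset.sum_range_succ, Finset.sum_eq_zero, zero_add, hqm, sub_self,
        Real.cos_zero, ← two_mul, sum_pow_div_coeff hk hk0 le_rfl]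
      · simp
      · intro j hj
        have := Finset.mem_range.1 hj
        exact z j (by omega) (by omega)
    · rw [if_neg hlm]
      exact Finset.sum_eq_zero fun j hj =>
        z j (by have := Finset.mem_range.1 hj; omega) (by omega)
end

theorem sum_coeff_mul_signedPsi_mul_cos {m : ℕ} {k : Fin (m + 1) → ℤ} {phase : Fin (m + 1) → ℝ}
    (hk : StrictMono k) (hk0 : k 0 = 0) (hphase : phase 0 = 0) {s t : ℝ}
    (hs : chiWronskian k phase s ≠ 0) (ht : chiWronskian k phase t ≠ 0) :
    ∑ i, coeff k i * signedPsi k phase i s * signedPsi k phase i t *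
      Real.cos ((k i : ℝ) * (s - t)) = 1 := by
  obtain ⟨q, hqm, hq⟩ := exists_monic_annihilator k phase hk0 hphase ht
  have e : ∀ i, coeff k i * signedPsi k phase i s * signedPsi k phase i t *
      Real.cos ((k i : ℝ) * (s - t)) = ∑ j ∈ Finset.range (m + 1),
        q j * (signedPsi k phase i s * iteratedDeriv j (chi k phase i) s) := by
    intro i
    -- This shift moves the argument of the cosines from `t` to `s` while the coefficients `q` stay
    -- frozen at `t`.
    have h := sum_mul_cos_shift hk hk0 hphase hq i ((k i : ℝ) * (t - s))
    rw [annihilator_chi_eq_coeff_mul_signedPsi hk hk0 hphase ht hqm hq i] at h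
    calc _ = signedPsi k phase i s *
          (coeff k i * signedPsi k phase i t * Real.cos ((k i : ℝ) * (t - s))) := by
          rw [← Real.cos_neg]; ring_nf
      _ = _ := by
          rw [← h, Finset.mul_sum]
          refine Finset.sum_congr rfl fun j _ => ?_
          rw [iteratedDeriv_chi]
          have : (k i : ℝ) * t + phase i + j * (Real.pi / 2) - (k i : ℝ) * (t - s)
            = (k i : ℝ) * s + phase i + j * (Real.pi / 2) := by ring
          rw [this]
          ring
  simp only [e]
  rw [Finset.sum_comm]
  simp only [← Finset.mul_sum]
  rw [Finset.sum_range_succ, Finset.sum_eq_zero, zero_add, hqm,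
    sum_signedPsi_mul_iteratedDeriv_chi k phase hs le_rfl, if_pos rfl, one_mul]
  intro j hj
  have := Finset.mem_range.1 hj
  rw [sum_signedPsi_mul_iteratedDeriv_chi k phase hs (by omega), if_neg (by omega), mul_zero]

/-! ### Smooth local polar coordinates -/

theorem norm_eq_sqrt_sq_add_sq (y : EuclideanSpace ℝ (Fin 2)) :
    ‖y‖ = Real.sqrt (y 0 ^ 2 + y 1 ^ 2) := by
  simp [EuclideanSpace.norm_eq, Fin.sum_univ_two]

theorem norm_sq_eq_sq_add_sq (y : EuclideanSpace ℝ (Fin 2)) : ‖y‖ ^ 2 = y 0 ^ 2 + y 1 ^ 2 := by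
  simp [EuclideanSpace.norm_sq_eq, Fin.sum_univ_two]

theorem polarPoint_norm_polarAngle (y : EuclideanSpace ℝ (Fin 2)) :
    polarPoint ‖y‖ (polarAngle y) = y := by
  have hn : ‖(⟨y 0, y 1⟩ : ℂ)‖ = ‖y‖ := by
    rw [norm_eq_sqrt_sq_add_sq, Complex.norm_eq_sqrt_sq_add_sq]
  have h := Complex.norm_mul_cos_add_sin_mul_I (⟨y 0, y 1⟩ : ℂ)
  rw [hn] at h
  ext i
  fin_cases i
  · simpa [polarPoint, polarAngle, ← Complex.ofReal_cos, ← Complex.ofReal_sin] using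
      congrArg Complex.re h
  · simpa [polarPoint, polarAngle, ← Complex.ofReal_cos, ← Complex.ofReal_sin] using
      congrArg Complex.im h

/-- The half-plane of the points whose polar angle differs from `α` by less than `π / 2`. -/
def halfPlane (α : ℝ) : Set (EuclideanSpace ℝ (Fin 2)) :=
  {y | 0 < y 0 * Real.cos α + y 1 * Real.sin α}

/-- The smooth polar angle on `halfPlane α` with values in `(α - π / 2, α + π / 2)`. -/
noncomputable def localAngle (α : ℝ) (y : EuclideanSpace ℝ (Fin 2)) : ℝ :=
  α + Real.arctan ((y 1 * Real.cos α - y 0 * Real.sin α) / (y 0 * Real.cos α + y 1 * Real.sin α))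

theorem isOpen_halfPlane (α : ℝ) : IsOpen (halfPlane α) :=
  isOpen_lt (by fun_prop) (by fun_prop)

theorem polarPoint_mem_halfPlane {r : ℝ} (hr : 0 < r) (α : ℝ) : polarPoint r α ∈ halfPlane α := by
  show 0 < r * Real.cos α * Real.cos α + r * Real.sin α * Real.sin α
  nlinarith [Real.sin_sq_add_cos_sq α]

theorem ne_zero_of_mem_halfPlane {α : ℝ} {y : EuclideanSpace ℝ (Fin 2)} (hy : y ∈ halfPlane α) :
    y ≠ 0 := by
  rintro rfl
  simp [halfPlane] at hy

theorem localAngle_polarPoint (r α : ℝ) : localAngle α (polarPoint r α) = α := by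
  have : r * Real.sin α * Real.cos α - r * Real.cos α * Real.sin α = 0 := by ring
  simp [localAngle, polarPoint, this]

theorem polarPoint_localAngle {α : ℝ} {y : EuclideanSpace ℝ (Fin 2)} (hy : y ∈ halfPlane α) :
    polarPoint ‖y‖ (localAngle α y) = y := by
  have hv : 0 < y 0 * Real.cos α + y 1 * Real.sin α := hy
  set v := y 0 * Real.cos α + y 1 * Real.sin α with hvdef
  set u := y 1 * Real.cos α - y 0 * Real.sin α with hudef
  have hcs := Real.sin_sq_add_cos_sq α
  -- Here `(v, u)` is `y` rotated by `-α`, with `v > 0`.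
  have hn : ‖y‖ = v * Real.sqrt (1 + (u / v) ^ 2) := by
    rw [norm_eq_sqrt_sq_add_sq, ← Real.sqrt_sq hv.le, ← Real.sqrt_mul (sq_nonneg v),
      Real.sqrt_sq hv.le]
    congr 1
    field_simp
    rw [hvdef, hudef]
    linear_combination (-(y 0) ^ 2 - y 1 ^ 2) * hcs
  have hs : 0 < Real.sqrt (1 + (u / v) ^ 2) := by positivity
  have hc : ‖y‖ * Real.cos (Real.arctan (u / v)) = v := by
    rw [hn, Real.cos_arctan]; field_simp
  have hsn : ‖y‖ * Real.sin (Real.arctan (u / v)) = u := by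
    rw [hn, Real.sin_arctan]; field_simp
  have e0 : ‖y‖ * Real.cos (α + Real.arctan (u / v)) = y 0 := by
    rw [Real.cos_add]
    linear_combination Real.cos α * hc - Real.sin α * hsn + y 0 * hcs
  have e1 : ‖y‖ * Real.sin (α + Real.arctan (u / v)) = y 1 := by
    rw [Real.sin_add]
    linear_combination Real.sin α * hc + Real.cos α * hsn + y 1 * hcs
  ext i
  fin_cases i
  · exact e0
  · exact e1

theorem contDiffAt_localAngle {α : ℝ} {y : EuclideanSpace ℝ (Fin 2)} (hy : y ∈ halfPlane α) :
    ContDiffAt ℝ ∞ (localAngle α) y := by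
  unfold localAngle
  have hv : y 0 * Real.cos α + y 1 * Real.sin α ≠ 0 := ne_of_gt hy
  refine contDiffAt_const.add (ContDiffAt.arctan (ContDiffAt.div ?_ ?_ hv)) <;> fun_prop

/-! ### Gradient and Laplacian of `r⁻ⁿ g(φ)` -/

/-- The covector with components `a`, `b` on the plane. -/
noncomputable def planeCovector (a b : ℝ) : EuclideanSpace ℝ (Fin 2) →L[ℝ] ℝ :=
  a • EuclideanSpace.proj 0 + b • EuclideanSpace.proj 1

theorem planeCovector_apply (a b : ℝ) (v : EuclideanSpace ℝ (Fin 2)) :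
    planeCovector a b v = a * v 0 + b * v 1 := rfl

theorem hasFDerivAt_coord_zero (y : EuclideanSpace ℝ (Fin 2)) :
    HasFDerivAt (fun y : EuclideanSpace ℝ (Fin 2) => y 0) (planeCovector 1 0) y := by
  convert! (EuclideanSpace.proj (𝕜 := ℝ) (0 : Fin 2)).hasFDerivAt using 1
  ext v
  simp [planeCovector_apply]

theorem hasFDerivAt_coord_one (y : EuclideanSpace ℝ (Fin 2)) :
    HasFDerivAt (fun y : EuclideanSpace ℝ (Fin 2) => y 1) (planeCovector 0 1) y := by
  convert! (EuclideanSpace.proj (𝕜 := ℝ) (1 : Fin 2)).hasFDerivAt using 1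
  ext v
  simp [planeCovector_apply]

theorem hasFDerivAt_norm_plane {y : EuclideanSpace ℝ (Fin 2)} (hy : y ≠ 0) :
    HasFDerivAt (fun y : EuclideanSpace ℝ (Fin 2) => ‖y‖)
      (planeCovector (y 0 / ‖y‖) (y 1 / ‖y‖)) y := by
  have hn : 0 < ‖y‖ := norm_pos_iff.2 hy
  have h := (((hasFDerivAt_coord_zero y).pow 2).add ((hasFDerivAt_coord_one y).pow 2)).sqrt
    (by have := norm_sq_eq_sq_add_sq y; simp only [Pi.add_apply]; rw [← this]; positivity)
  simp only [Pi.add_apply, ← norm_eq_sqrt_sq_add_sq] at h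
  convert! h using 1
  ext v
  simp [planeCovector_apply]
  field_simp

theorem hasFDerivAt_localAngle {α : ℝ} {y : EuclideanSpace ℝ (Fin 2)} (hy : y ∈ halfPlane α) :
    HasFDerivAt (localAngle α) (planeCovector (-y 1 / ‖y‖ ^ 2) (y 0 / ‖y‖ ^ 2)) y := by
  have hv : 0 < y 0 * Real.cos α + y 1 * Real.sin α := hy
  have hn : ‖y‖ ≠ 0 := norm_ne_zero_iff.2 (ne_zero_of_mem_halfPlane hy)
  have h0 := hasFDerivAt_coord_zero y
  have h1 := hasFDerivAt_coord_one y
  have hd := (h0.mul_const (Real.cos α)).fun_add (h1.mul_const (Real.sin α))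
  have h := (((h1.mul_const (Real.cos α)).fun_sub (h0.mul_const (Real.sin α))).fun_mul
    ((hasDerivAt_inv hv.ne').comp_hasFDerivAt y hd)).arctan.const_add α
  have hcs := Real.sin_sq_add_cos_sq α
  have hu : (y 0 * Real.cos α + y 1 * Real.sin α) ^ 2 +
      (y 1 * Real.cos α - y 0 * Real.sin α) ^ 2 = ‖y‖ ^ 2 := by
    rw [norm_sq_eq_sq_add_sq]
    linear_combination (y 0 ^ 2 + y 1 ^ 2) * hcs
  refine h.congr_fderiv ?_
  ext w
  simp only [planeCovector_apply, Function.comp_apply, add_apply,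
    smul_apply, sub_apply, smul_eq_mul]
  set v := y 0 * Real.cos α + y 1 * Real.sin α with hvdef
  set u := y 1 * Real.cos α - y 0 * Real.sin α with hudef
  have e : 1 + (u * v⁻¹) ^ 2 = ‖y‖ ^ 2 / v ^ 2 := by
    rw [← hu]; field_simp
  rw [e]
  field_simp
  rw [hvdef, hudef]
  linear_combination (w 1 * y 0 - w 0 * y 1) * hcs

/-- The gradient of `r⁻ᴺ g(φ)` in Cartesian coordinates. -/
theorem hasFDerivAt_inv_pow_mul_angular {α : ℝ} {y : EuclideanSpace ℝ (Fin 2)}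
    (hy : y ∈ halfPlane α) (N : ℕ) {g : ℝ → ℝ} {g' : ℝ}
    (hg : HasDerivAt g g' (localAngle α y)) :
    HasFDerivAt (fun y => (‖y‖ ^ N)⁻¹ * g (localAngle α y))
      (planeCovector ((‖y‖ ^ (N + 2))⁻¹ * (-N * y 0 * g (localAngle α y) - y 1 * g'))
        ((‖y‖ ^ (N + 2))⁻¹ * (-N * y 1 * g (localAngle α y) + y 0 * g'))) y := by
  have h0 := ne_zero_of_mem_halfPlane hy
  have hn : 0 < ‖y‖ := norm_pos_iff.2 h0
  have hN : ‖y‖ ^ N ≠ 0 := by positivity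
  have h1 := ((hasDerivAt_pow N ‖y‖).fun_inv hN).comp_hasFDerivAt y (hasFDerivAt_norm_plane h0)
  have h := h1.fun_mul (hg.comp_hasFDerivAt y (hasFDerivAt_localAngle hy))
  refine h.congr_fderiv ?_
  ext w
  simp only [planeCovector_apply, Function.comp_apply, add_apply,
    smul_apply, smul_eq_mul]
  rcases N with _ | N
  · simp
    field_simp
  · simp only [Nat.add_sub_cancel]
    field_simp
    ring

theorem laplacian_eq_of_hasFDerivAt {f P Q : EuclideanSpace ℝ (Fin 2) → ℝ}
    {x : EuclideanSpace ℝ (Fin 2)} {a b c d : ℝ}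
    (hf : ∀ᶠ y in nhds x, HasFDerivAt f (planeCovector (P y) (Q y)) y)
    (hP : HasFDerivAt P (planeCovector a b) x) (hQ : HasFDerivAt Q (planeCovector c d) x) :
    Laplacian.laplacian f x = a + d := by
  rw [InnerProductSpace.laplacian_eq_iteratedFDeriv_orthonormalBasis f
    (EuclideanSpace.basisFun (Fin 2) ℝ)]
  have h1 : fderiv ℝ f =ᶠ[nhds x] fun y => planeCovector (P y) (Q y) := by
    filter_upwards [hf] with y hy using hy.fderiv
  have h2 := (hP.smul_const (EuclideanSpace.proj (𝕜 := ℝ) (0 : Fin 2))).fun_add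
    (hQ.smul_const (EuclideanSpace.proj (𝕜 := ℝ) (1 : Fin 2)))
  simp only [iteratedFDeriv_two_apply, h1.fderiv_eq]
  unfold planeCovector at h2 ⊢
  rw [h2.fderiv]
  simp [Fin.sum_univ_two]

/-- The Laplacian of `r⁻ⁿ g(φ)`. -/
theorem laplacian_inv_pow_mul_angular {α : ℝ} {x : EuclideanSpace ℝ (Fin 2)}
    (hx : x ∈ halfPlane α) (n : ℕ) {g g' : ℝ → ℝ} {g'' : ℝ}
    (hg : ∀ᶠ s in nhds (localAngle α x), HasDerivAt g (g' s) s)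
    (hg' : HasDerivAt g' g'' (localAngle α x)) :
    Laplacian.laplacian (fun y => (‖y‖ ^ n)⁻¹ * g (localAngle α y)) x =
      (‖x‖ ^ (n + 2))⁻¹ * (n ^ 2 * g (localAngle α x) + g'') := by
  have hn : 0 < ‖x‖ := norm_pos_iff.2 (ne_zero_of_mem_halfPlane hx)
  -- The components of the gradient are combinations of coordinates times `r⁻⁽ⁿ⁺²⁾ g` and `r⁻⁽ⁿ⁺²⁾
  -- g'`, so the gradient formula applies a second time with exponent `n + 2`.
  have hG := hasFDerivAt_inv_pow_mul_angular hx (n + 2) hg.self_of_nhds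
  have hG' := hasFDerivAt_inv_pow_mul_angular hx (n + 2) hg'
  have h0 := hasFDerivAt_coord_zero x
  have h1 := hasFDerivAt_coord_one x
  have hP := (((h0.const_mul (-(n : ℝ))).fun_mul hG).fun_sub (h1.fun_mul hG'))
  have hQ := (((h1.const_mul (-(n : ℝ))).fun_mul hG).fun_add (h0.fun_mul hG'))
  have hcov : ∀ L : EuclideanSpace ℝ (Fin 2) →L[ℝ] ℝ, L = planeCovector
      (L (EuclideanSpace.single 0 1)) (L (EuclideanSpace.single 1 1)) := by
    intro L
    ext v
    rw [planeCovector_apply]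
    conv_lhs => rw [show v = v 0 • EuclideanSpace.single 0 (1 : ℝ) +
      v 1 • EuclideanSpace.single 1 (1 : ℝ) by ext i; fin_cases i <;> simp]
    rw [map_add, map_smul, map_smul, smul_eq_mul, smul_eq_mul]
    ring
  rw [hcov (_ - _)] at hP
  rw [hcov (_ + _)] at hQ
  rw [laplacian_eq_of_hasFDerivAt (P := _) (Q := _) ?_ hP hQ]
  · simp only [planeCovector_apply, add_apply, smul_apply, sub_apply, smul_eq_mul]
    simp
    have hsq : ‖x‖ ^ (n + 2 + 2) = ‖x‖ ^ (n + 2) * (x 0 ^ 2 + x 1 ^ 2) := by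
      rw [← norm_sq_eq_sq_add_sq]; ring
    have hpos : x 0 ^ 2 + x 1 ^ 2 ≠ 0 := by rw [← norm_sq_eq_sq_add_sq]; positivity
    rw [hsq]
    field_simp
    ring
  · have hc := (contDiffAt_localAngle hx).continuousAt.eventually hg
    filter_upwards [hc, (isOpen_halfPlane α).mem_nhds hx] with y hy hyα
    refine (hasFDerivAt_inv_pow_mul_angular hyα n hy).congr_fderiv ?_
    congr 1 <;> ring

/-! ### The explicit coefficients and their smoothness -/

theorem contDiff_chebyshevDeriv (N : ℤ) (ν : ℕ) : ContDiff ℝ ∞ (chebyshevDeriv N ν) :=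
  by
  unfold chebyshevDeriv
  simp only [Polynomial.eval_eq_sum, Polynomial.sum]
  fun_prop

theorem hasDerivAt_chebyshevDeriv (N : ℤ) (ν : ℕ) (z : ℝ) :
    HasDerivAt (chebyshevDeriv N ν) (chebyshevDeriv N (ν + 1) z) z := by
  unfold chebyshevDeriv
  rw [Function.iterate_succ_apply']
  exact Polynomial.hasDerivAt _ z

/-- The angular part of the Hadamard coefficients. -/
noncomputable def angularSum {m : ℕ} (k : Fin (m + 1) → ℤ) (phase : Fin (m + 1) → ℝ) (ν : ℕ)
    (s t : ℝ) : ℝ :=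
  ∑ i, coeff k i * Psi k phase i s * Psi k phase i t * chebyshevDeriv (k i) ν (Real.cos (s - t))

/-- The function of the plane with polar form
`(-2)^ν / (r ρ)^ν ∑ c_i Ψ_i(φ) Ψ_i(θ) T_{k_i}^{(ν)}(cos (φ - θ))`. -/
noncomputable def hadamardCoeff {m : ℕ} (k : Fin (m + 1) → ℤ) (phase : Fin (m + 1) → ℝ) (ν : ℕ)
    (x ξ : EuclideanSpace ℝ (Fin 2)) : ℝ :=
  (-2) ^ ν / (‖x‖ * ‖ξ‖) ^ ν * angularSum k phase ν (polarAngle x) (polarAngle ξ)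

section
variable {m : ℕ} (k : Fin (m + 1) → ℤ) (phase : Fin (m + 1) → ℝ)

theorem angularSum_eq_sum_signedPsi (ν : ℕ) (s t : ℝ) :
    angularSum k phase ν s t = ∑ i, coeff k i * signedPsi k phase i t *
      (signedPsi k phase i s * chebyshevDeriv (k i) ν (Real.cos (s - t))) := by
  refine Finset.sum_congr rfl fun i _ => ?_
  linear_combination (-coeff k i * chebyshevDeriv (k i) ν (Real.cos (s - t))) *
    signedPsi_mul_signedPsi k phase i s t

theorem hadamardCoeff_polarPoint (ν : ℕ) {r ρ : ℝ} (hr : 0 < r) (hρ : 0 < ρ) (s t : ℝ) :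
    hadamardCoeff k phase ν (polarPoint r s) (polarPoint ρ t) =
      (-2) ^ ν / (r * ρ) ^ ν * angularSum k phase ν s t := by
  obtain ⟨a, ha⟩ := polarAngle_polarPoint hr s
  obtain ⟨b, hb⟩ := polarAngle_polarPoint hρ t
  unfold hadamardCoeff angularSum
  rw [norm_polarPoint hr, norm_polarPoint hρ, ha, hb]
  have h : s + 2 * Real.pi * a - (t + 2 * Real.pi * b) =
      s - t + ((a - b : ℤ) : ℝ) * (2 * Real.pi) := by
    push_cast; ring
  simp only [Psi_add_two_pi, h, Real.cos_add_int_mul_two_pi]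

theorem hadamardCoeff_of_mem_halfPlane (ν : ℕ) {α β : ℝ} {x ξ : EuclideanSpace ℝ (Fin 2)}
    (hx : x ∈ halfPlane α) (hξ : ξ ∈ halfPlane β) :
    hadamardCoeff k phase ν x ξ = (-2) ^ ν / (‖x‖ * ‖ξ‖) ^ ν *
      angularSum k phase ν (localAngle α x) (localAngle β ξ) := by
  have hx0 := norm_pos_iff.2 (ne_zero_of_mem_halfPlane hx)
  have hξ0 := norm_pos_iff.2 (ne_zero_of_mem_halfPlane hξ)
  rw [← hadamardCoeff_polarPoint k phase ν hx0 hξ0, polarPoint_localAngle hx,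
    polarPoint_localAngle hξ]

theorem mem_halfPlane_polarAngle {x : EuclideanSpace ℝ (Fin 2)} (hx : x ≠ 0) :
    x ∈ halfPlane (polarAngle x) := by
  have h := polarPoint_mem_halfPlane (norm_pos_iff.2 hx) (polarAngle x)
  rwa [polarPoint_norm_polarAngle] at h

theorem localAngle_polarAngle (x : EuclideanSpace ℝ (Fin 2)) :
    localAngle (polarAngle x) x = polarAngle x := by
  have h := localAngle_polarPoint ‖x‖ (polarAngle x)
  rwa [polarPoint_norm_polarAngle] at h

/-- The principal angle `polarAngle` jumps across the negative axis; periodicity allows replacing it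
near each point by a smooth `localAngle`. -/
theorem contDiffAt_hadamardCoeff (ν : ℕ) {x ξ : EuclideanSpace ℝ (Fin 2)}
    (hx : x ∈ regularSet k phase) (hξ : ξ ∈ regularSet k phase) :
    ContDiffAt ℝ ∞ (fun p : EuclideanSpace ℝ (Fin 2) × EuclideanSpace ℝ (Fin 2) =>
      hadamardCoeff k phase ν p.1 p.2) (x, ξ) := by
  have hx1 := mem_halfPlane_polarAngle hx.1
  have hξ1 := mem_halfPlane_polarAngle hξ.1
  have he : (fun p : EuclideanSpace ℝ (Fin 2) × EuclideanSpace ℝ (Fin 2) =>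
      hadamardCoeff k phase ν p.1 p.2) =ᶠ[nhds (x, ξ)] fun p =>
      (-2) ^ ν / (‖p.1‖ * ‖p.2‖) ^ ν * angularSum k phase ν
        (localAngle (polarAngle x) p.1) (localAngle (polarAngle ξ) p.2) := by
    filter_upwards [prod_mem_nhds ((isOpen_halfPlane _).mem_nhds hx1)
      ((isOpen_halfPlane _).mem_nhds hξ1)] with p hp
    exact hadamardCoeff_of_mem_halfPlane k phase ν hp.1 hp.2
  refine ContDiffAt.congr_of_eventuallyEq ?_ he
  have c1 : ContDiffAt ℝ ∞ (fun p : EuclideanSpace ℝ (Fin 2) × EuclideanSpace ℝ (Fin 2) =>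
      localAngle (polarAngle x) p.1) (x, ξ) :=
    ContDiffAt.comp (g := localAngle (polarAngle x)) (x, ξ) (contDiffAt_localAngle hx1)
      contDiffAt_fst
  have c2 : ContDiffAt ℝ ∞ (fun p : EuclideanSpace ℝ (Fin 2) × EuclideanSpace ℝ (Fin 2) =>
      localAngle (polarAngle ξ) p.2) (x, ξ) :=
    ContDiffAt.comp (g := localAngle (polarAngle ξ)) (x, ξ) (contDiffAt_localAngle hξ1)
      contDiffAt_snd
  have n1 : ContDiffAt ℝ ∞ (fun p : EuclideanSpace ℝ (Fin 2) × EuclideanSpace ℝ (Fin 2) =>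
      ‖p.1‖) (x, ξ) := contDiffAt_fst.norm ℝ hx.1
  have n2 : ContDiffAt ℝ ∞ (fun p : EuclideanSpace ℝ (Fin 2) × EuclideanSpace ℝ (Fin 2) =>
      ‖p.2‖) (x, ξ) := contDiffAt_snd.norm ℝ hξ.1
  refine ContDiffAt.mul (contDiffAt_const.div ((n1.mul n2).pow ν) ?_) ?_
  · exact pow_ne_zero _ (mul_ne_zero (norm_ne_zero_iff.2 hx.1) (norm_ne_zero_iff.2 hξ.1))
  · simp only [angularSum_eq_sum_signedPsi]
    have p1 : ∀ i, ContDiffAt ℝ ∞ (fun p : EuclideanSpace ℝ (Fin 2) × EuclideanSpace ℝ (Fin 2) =>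
        signedPsi k phase i (localAngle (polarAngle x) p.1)) (x, ξ) := fun i =>
      ContDiffAt.comp (g := signedPsi k phase i) (x, ξ) (contDiffAt_signedPsi k phase i
        (by simpa only [localAngle_polarAngle] using hx.2)) c1
    have p2 : ∀ i, ContDiffAt ℝ ∞ (fun p : EuclideanSpace ℝ (Fin 2) × EuclideanSpace ℝ (Fin 2) =>
        signedPsi k phase i (localAngle (polarAngle ξ) p.2)) (x, ξ) := fun i =>
      ContDiffAt.comp (g := signedPsi k phase i) (x, ξ) (contDiffAt_signedPsi k phase i
        (by simpa only [localAngle_polarAngle] using hξ.2)) c2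
    refine ContDiffAt.sum fun i _ => (contDiffAt_const.mul (p2 i)).mul ((p1 i).mul ?_)
    exact (contDiff_chebyshevDeriv (k i) ν).contDiffAt.comp (x, ξ) (c1.sub c2).cos

/-! ### The transport equations -/

/-- The derivative of `angularSum` in its first angle. -/
noncomputable def angularSumDeriv (ν : ℕ) (s t : ℝ) : ℝ :=
  ∑ i, coeff k i * signedPsi k phase i t *
    (deriv (signedPsi k phase i) s * chebyshevDeriv (k i) ν (Real.cos (s - t)) +
      signedPsi k phase i s * (chebyshevDeriv (k i) (ν + 1) (Real.cos (s - t)) * -Real.sin (s - t)))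

/-- The second derivative of `angularSum` in its first angle. -/
noncomputable def angularSumDerivTwo (ν : ℕ) (s t : ℝ) : ℝ :=
  ∑ i, coeff k i * signedPsi k phase i t *
    ((deriv (deriv (signedPsi k phase i)) s * chebyshevDeriv (k i) ν (Real.cos (s - t)) +
      deriv (signedPsi k phase i) s *
        (chebyshevDeriv (k i) (ν + 1) (Real.cos (s - t)) * -Real.sin (s - t))) +
      (deriv (signedPsi k phase i) s *
        (chebyshevDeriv (k i) (ν + 1) (Real.cos (s - t)) * -Real.sin (s - t)) +
      signedPsi k phase i s *
        (chebyshevDeriv (k i) (ν + 2) (Real.cos (s - t)) * -Real.sin (s - t) * -Real.sin (s - t) +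
          chebyshevDeriv (k i) (ν + 1) (Real.cos (s - t)) * -Real.cos (s - t))))

variable {k phase}

theorem hasDerivAt_chebyshevDeriv_cos (N : ℤ) (ν : ℕ) (s t : ℝ) :
    HasDerivAt (fun s => chebyshevDeriv N ν (Real.cos (s - t)))
      (chebyshevDeriv N (ν + 1) (Real.cos (s - t)) * -Real.sin (s - t)) s := by
  have h : HasDerivAt (fun s => Real.cos (s - t)) (-Real.sin (s - t)) s := by
    simpa using ((hasDerivAt_id s).sub_const t).cos
  exact (hasDerivAt_chebyshevDeriv N ν (Real.cos (s - t))).comp s h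

theorem hasDerivAt_angularSum (ν : ℕ) {s : ℝ} (t : ℝ) (hs : chiWronskian k phase s ≠ 0) :
    HasDerivAt (fun s => angularSum k phase ν s t) (angularSumDeriv k phase ν s t) s := by
  simp only [angularSum_eq_sum_signedPsi]
  exact HasDerivAt.fun_sum fun i _ => ((hasDerivAt_signedPsi i hs).mul
    (hasDerivAt_chebyshevDeriv_cos (k i) ν s t)).const_mul _

theorem hasDerivAt_angularSumDeriv (ν : ℕ) {s : ℝ} (t : ℝ) (hs : chiWronskian k phase s ≠ 0) :
    HasDerivAt (fun s => angularSumDeriv k phase ν s t) (angularSumDerivTwo k phase ν s t) s := by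
  have h : HasDerivAt (fun s => -Real.sin (s - t)) (-Real.cos (s - t)) s := by
    simpa using ((hasDerivAt_id s).sub_const t).sin.fun_neg
  exact HasDerivAt.fun_sum fun i _ => (((hasDerivAt_deriv_signedPsi i hs).mul
    (hasDerivAt_chebyshevDeriv_cos (k i) ν s t)).add ((hasDerivAt_signedPsi i hs).mul
    ((hasDerivAt_chebyshevDeriv_cos (k i) (ν + 1) s t).mul h))).const_mul _

/-- The angular form of the transport equation. -/
theorem angularSum_transport (ν : ℕ) {s : ℝ} (t : ℝ) (hs : chiWronskian k phase s ≠ 0) :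
    ν ^ 2 * angularSum k phase ν s t + angularSumDerivTwo k phase ν s t +
      2 * iteratedDeriv 2 (fun u => Real.log (chiWronskian k phase u)) s *
        angularSum k phase ν s t =
    -2 * ((ν + 1) * Real.cos (s - t) * angularSum k phase (ν + 1) s t +
      Real.sin (s - t) * angularSumDeriv k phase (ν + 1) s t) := by
  simp only [angularSum_eq_sum_signedPsi, angularSumDeriv, angularSumDerivTwo, Finset.mul_sum,
    ← Finset.sum_add_distrib]
  refine Finset.sum_congr rfl fun i _ => ?_
  rw [deriv_deriv_signedPsi k phase hs i]
  -- The Chebyshev differential equation, differentiated `ν` times, at `cos (s - t)`. The terms with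
  -- `Ψ_i'` already agree on both sides.
  have hT : (1 - Real.cos (s - t) ^ 2) * chebyshevDeriv (k i) (ν + 2) (Real.cos (s - t)) =
      (2 * ν + 1) * Real.cos (s - t) * chebyshevDeriv (k i) (ν + 1) (Real.cos (s - t)) -
      ((k i : ℝ) ^ 2 - (ν : ℝ) ^ 2) * chebyshevDeriv (k i) ν (Real.cos (s - t)) :=
    Polynomial.Chebyshev.one_sub_X_sq_mul_iterate_derivative_T_eval (k i) ν (Real.cos (s - t))
  have hsq := Real.sin_sq_add_cos_sq (s - t)
  have e : ν + 1 + 1 = ν + 2 := rfl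
  rw [e]
  linear_combination (-coeff k i * signedPsi k phase i t * signedPsi k phase i s) * hT -
    (coeff k i * signedPsi k phase i t * signedPsi k phase i s *
      chebyshevDeriv (k i) (ν + 2) (Real.cos (s - t))) * hsq

theorem hadamardCoeff_eventuallyEq (ν : ℕ) {x ξ : EuclideanSpace ℝ (Fin 2)} (hx : x ≠ 0)
    (hξ : ξ ≠ 0) :
    (fun y => hadamardCoeff k phase ν y ξ) =ᶠ[nhds x] fun y => (‖y‖ ^ ν)⁻¹ *
      (fun s => (-2) ^ ν / ‖ξ‖ ^ ν * angularSum k phase ν s (polarAngle ξ))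
        (localAngle (polarAngle x) y) := by
  filter_upwards [(isOpen_halfPlane _).mem_nhds (mem_halfPlane_polarAngle hx)] with y hy
  rw [hadamardCoeff_of_mem_halfPlane k phase ν hy (mem_halfPlane_polarAngle hξ),
    localAngle_polarAngle ξ, mul_pow, div_mul_eq_div_div]
  ring

theorem hadamardCoeff_transport (ν : ℕ) {x ξ : EuclideanSpace ℝ (Fin 2)}
    (hx : x ∈ regularSet k phase) (hξ : ξ ≠ 0) :
    fderiv ℝ (fun y => hadamardCoeff k phase (ν + 1) y ξ) x (x - ξ) +
        ((ν : ℝ) + 1) * hadamardCoeff k phase (ν + 1) x ξ =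
      -(schrodinger (potential k phase) (fun y => hadamardCoeff k phase ν y ξ) x) := by
  set α := polarAngle x with hα
  set β := polarAngle ξ with hβ
  have hxα : x ∈ halfPlane α := mem_halfPlane_polarAngle hx.1
  have hαx : localAngle α x = α := localAngle_polarAngle x
  have hD : chiWronskian k phase α ≠ 0 := hx.2
  have hrx : 0 < ‖x‖ := norm_pos_iff.2 hx.1
  have hrξ : 0 < ‖ξ‖ := norm_pos_iff.2 hξ
  have hg := fun (n : ℕ) {s : ℝ} (hs : chiWronskian k phase s ≠ 0) =>
    (hasDerivAt_angularSum n β hs).const_mul ((-2) ^ n / ‖ξ‖ ^ n)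
  have hg' := (hasDerivAt_angularSumDeriv ν β hD).const_mul ((-2) ^ ν / ‖ξ‖ ^ ν)
  have hF := (hadamardCoeff_eventuallyEq (k := k) (phase := phase) (ν + 1) hx.1 hξ).fderiv_eq
    (𝕜 := ℝ)
  have hF2 := hasFDerivAt_inv_pow_mul_angular hxα (ν + 1)
    (g := fun s => (-2) ^ (ν + 1) / ‖ξ‖ ^ (ν + 1) * angularSum k phase (ν + 1) s β)
    (by rw [hαx]; exact hg (ν + 1) hD)
  have hLap := (InnerProductSpace.laplacian_congr_nhds
    (hadamardCoeff_eventuallyEq (k := k) (phase := phase) ν hx.1 hξ)).self_of_nhds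
  have hLap2 := laplacian_inv_pow_mul_angular hxα ν
    (g := fun s => (-2) ^ ν / ‖ξ‖ ^ ν * angularSum k phase ν s β)
    (g' := fun s => (-2) ^ ν / ‖ξ‖ ^ ν * angularSumDeriv k phase ν s β)
    (by
      rw [hαx]
      filter_upwards [(isOpen_chiWronskian_ne_zero k phase).mem_nhds hD] with s hs
      exact hg ν hs)
    (by rw [hαx]; exact hg')
  have hU := fun n : ℕ =>
    hadamardCoeff_of_mem_halfPlane k phase n hxα (mem_halfPlane_polarAngle hξ)
  rw [← hα] at hF hLap
  rw [← hβ] at hF hLap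
  unfold schrodinger potential
  rw [hF, hLap, hF2.fderiv, hLap2, planeCovector_apply]
  simp only [hU, ← hα, ← hβ, hαx, show localAngle β ξ = β from localAngle_polarAngle ξ]
  have x0 : x 0 = ‖x‖ * Real.cos α :=
    congrArg (fun y : EuclideanSpace ℝ (Fin 2) => y 0) (polarPoint_norm_polarAngle x).symm
  have x1 : x 1 = ‖x‖ * Real.sin α :=
    congrArg (fun y : EuclideanSpace ℝ (Fin 2) => y 1) (polarPoint_norm_polarAngle x).symm
  have ξ0 : ξ 0 = ‖ξ‖ * Real.cos β :=
    congrArg (fun y : EuclideanSpace ℝ (Fin 2) => y 0) (polarPoint_norm_polarAngle ξ).symm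
  have ξ1 : ξ 1 = ‖ξ‖ * Real.sin β :=
    congrArg (fun y : EuclideanSpace ℝ (Fin 2) => y 1) (polarPoint_norm_polarAngle ξ).symm
  have hT := angularSum_transport ν β hD
  have hcs := Real.sin_sq_add_cos_sq α
  rw [Real.cos_sub, Real.sin_sub] at hT
  simp only [PiLp.sub_apply, x0, x1, ξ0, ξ1]
  set r := ‖x‖
  set ρ := ‖ξ‖
  set A := angularSum k phase ν α β
  set B := angularSumDerivTwo k phase ν α β
  set S := angularSum k phase (ν + 1) α β
  set S' := angularSumDeriv k phase (ν + 1) α β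
  set v := iteratedDeriv 2 (fun u => Real.log (chiWronskian k phase u)) α
  -- As `U_{ν+1}` is homogeneous of degree `-(ν + 1)` in `x`, the part `(x, ∂_x)` cancels `(ν + 1)
  -- U_{ν+1}`; only `-(ξ, ∂_x) U_{ν+1}` remains.
  calc _ = ((-2) ^ ν / (ρ ^ ν * r ^ (ν + 2))) * (-2 * ((ν + 1) *
        (Real.cos α * Real.cos β + Real.sin α * Real.sin β) * S +
        (Real.sin α * Real.cos β - Real.cos α * Real.sin β) * S')) := by
        push_cast
        field_simp
        linear_combination
          (2 * (ν + 1) * r ^ 5 * r ^ (ν * 2) * S * ρ * ρ ^ (ν * 2) * (-2) ^ ν) * hcs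
    _ = _ := by
        rw [← hT]
        field_simp
        ring
end

/-! ### Normalisation, vanishing and existence -/

theorem hadamardCoeff_zero {m : ℕ} {k : Fin (m + 1) → ℤ} {phase : Fin (m + 1) → ℝ}
    (hk : StrictMono k) (hk0 : k 0 = 0) (hphase : phase 0 = 0) {x ξ : EuclideanSpace ℝ (Fin 2)}
    (hx : x ∈ regularSet k phase) (hξ : ξ ∈ regularSet k phase) :
    hadamardCoeff k phase 0 x ξ = 1 := by
  unfold hadamardCoeff
  rw [angularSum_eq_sum_signedPsi, pow_zero, pow_zero, div_one, one_mul,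
    ← sum_coeff_mul_signedPsi_mul_cos hk hk0 hphase hx.2 hξ.2]
  refine Finset.sum_congr rfl fun i _ => ?_
  have : chebyshevDeriv (k i) 0 (Real.cos (polarAngle x - polarAngle ξ)) =
      Real.cos ((k i : ℝ) * (polarAngle x - polarAngle ξ)) :=
    Polynomial.Chebyshev.T_real_cos _ _
  rw [this]
  ring

theorem hadamardCoeff_eq_zero {m : ℕ} {k : Fin (m + 1) → ℤ} (phase : Fin (m + 1) → ℝ)
    (hk : StrictMono k) (hk0 : k 0 = 0) {ν : ℕ} (hν : k (Fin.last m) < (ν : ℤ))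
    (x ξ : EuclideanSpace ℝ (Fin 2)) : hadamardCoeff k phase ν x ξ = 0 := by
  unfold hadamardCoeff angularSum
  rw [Finset.sum_eq_zero, mul_zero]
  intro i _
  have h : Polynomial.derivative^[ν] (Polynomial.Chebyshev.T ℝ (k i)) = 0 := by
    refine Polynomial.iterate_derivative_eq_zero_of_degree_lt ?_
    rw [Polynomial.Chebyshev.degree_T]
    have h1 := hk.monotone (Fin.le_last i)
    have h2 := nonneg_of_strictMono hk hk0 i
    exact_mod_cast (by omega : (k i).natAbs < ν)
  rw [chebyshevDeriv, h, Polynomial.eval_zero, mul_zero]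

theorem isHadamardCoefficients_hadamardCoeff {m : ℕ} {k : Fin (m + 1) → ℤ}
    {phase : Fin (m + 1) → ℝ} (hk : StrictMono k) (hk0 : k 0 = 0) (hphase : phase 0 = 0)
    {Ω : Set (EuclideanSpace ℝ (Fin 2))} (hΩ : Ω ⊆ regularSet k phase) :
    IsHadamardCoefficients (potential k phase) Ω (hadamardCoeff k phase) where
  smooth ν _ hp := (contDiffAt_hadamardCoeff k phase ν (hΩ hp.1) (hΩ hp.2)).contDiffWithinAt
  zero_eq_one _ hx _ hξ := hadamardCoeff_zero hk hk0 hphase (hΩ hx) (hΩ hξ)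
  transport ν _ hx _ hξ := hadamardCoeff_transport ν (hΩ hx) (hΩ hξ).1

/-! ### Uniqueness along segments -/

/-- Compactness of `[0, 1]`. The induction for uniqueness needs equality near a point, not only at
it, because the Laplacian enters. -/
theorem eventually_segment_subset {E : Type*} [NormedAddCommGroup E] [NormedSpace ℝ E] {Ω : Set E}
    (hΩ : IsOpen Ω) {x ξ : E} (h : segment ℝ ξ x ⊆ Ω) : ∀ᶠ y in nhds x, segment ℝ ξ y ⊆ Ω := by
  simp only [segment_eq_image', Set.image_subset_iff] at h ⊢
  refine isCompact_Icc.eventually_forall_of_forall_eventually fun t ht => ?_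
  have hc : Continuous fun z : E × ℝ => ξ + z.2 • (z.1 - ξ) := by fun_prop
  exact hc.continuousAt.eventually_mem (hΩ.mem_nhds (h ht))

/-- Hadamard coefficients are unique on segments. -/
theorem IsHadamardCoefficients.eq_of_segment_subset {n : ℕ} {V : EuclideanSpace ℝ (Fin n) → ℝ}
    {Ω : Set (EuclideanSpace ℝ (Fin n))} (hΩ : IsOpen Ω)
    {U U' : ℕ → EuclideanSpace ℝ (Fin n) → EuclideanSpace ℝ (Fin n) → ℝ}
    (hU : IsHadamardCoefficients V Ω U) (hU' : IsHadamardCoefficients V Ω U') (ν : ℕ)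
    {x ξ : EuclideanSpace ℝ (Fin n)} (h : segment ℝ ξ x ⊆ Ω) : U' ν x ξ = U ν x ξ := by
  induction ν generalizing x with
  | zero =>
    have hx := h (right_mem_segment ℝ ξ x)
    have hξ := h (left_mem_segment ℝ ξ x)
    rw [hU.zero_eq_one x hx ξ hξ, hU'.zero_eq_one x hx ξ hξ]
  | succ ν ih =>
    have hξ : ξ ∈ Ω := h (left_mem_segment ℝ ξ x)
    have hdiff : ∀ {W : ℕ → EuclideanSpace ℝ (Fin n) → EuclideanSpace ℝ (Fin n) → ℝ},
        IsHadamardCoefficients V Ω W → ∀ y ∈ Ω, DifferentiableAt ℝ (fun y => W (ν + 1) y ξ) y := by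
      intro W hW y hy
      have h1 := ((hW.smooth (ν + 1)).contDiffAt (x := (y, ξ))
        ((hΩ.prod hΩ).mem_nhds ⟨hy, hξ⟩)).differentiableAt (by simp)
      exact DifferentiableAt.comp (f := fun y => (y, ξ)) y h1
        (differentiableAt_id.prodMk (differentiableAt_const ξ))
    set p : ℝ → EuclideanSpace ℝ (Fin n) := fun t => ξ + t • (x - ξ) with hp
    have hpseg : ∀ t ∈ Set.Icc (0 : ℝ) 1, segment ℝ ξ (p t) ⊆ Ω := by
      intro t ht
      refine ((convex_segment ξ x).segment_subset (left_mem_segment ℝ ξ x) ?_).trans h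
      rw [segment_eq_image']
      exact ⟨t, ht, rfl⟩
    have hdp : ∀ t, HasDerivAt p (x - ξ) t := fun t => by
      have h1 : HasDerivAt (fun t : ℝ => t • (x - ξ)) (x - ξ) t := by
        simpa using (hasDerivAt_id t).smul_const (x - ξ)
      exact h1.const_add ξ
    -- The integrating factor `t^(ν+1)` turns the homogeneous transport equation into a vanishing
    -- derivative. It is zero at `t = 0`, where smoothness on the diagonal keeps the difference
    -- finite, so the constant is `0`.
    have hder : ∀ t ∈ Set.Icc (0 : ℝ) 1, HasDerivAt
        (fun t => t ^ (ν + 1) * (U' (ν + 1) (p t) ξ - U (ν + 1) (p t) ξ)) 0 t := by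
      intro t ht
      have hpΩ : p t ∈ Ω := hpseg t ht (right_mem_segment ℝ _ _)
      have e : (fun y => U' ν y ξ) =ᶠ[nhds (p t)] fun y => U ν y ξ := by
        filter_upwards [eventually_segment_subset hΩ (hpseg t ht)] with y hy using ih hy
      have hs : schrodinger V (fun y => U' ν y ξ) (p t) =
          schrodinger V (fun y => U ν y ξ) (p t) := by
        unfold schrodinger
        rw [(InnerProductSpace.laplacian_congr_nhds e).self_of_nhds, e.self_of_nhds]
      have h1 := hU.transport ν (p t) hpΩ ξ hξ
      have h2 := hU'.transport ν (p t) hpΩ ξ hξ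
      have hpt : p t - ξ = t • (x - ξ) := by simp [hp]
      rw [hpt, map_smul, smul_eq_mul] at h1 h2
      have d1 := (hdiff hU (p t) hpΩ).hasFDerivAt.comp_hasDerivAt t (hdp t)
      have d2 := (hdiff hU' (p t) hpΩ).hasFDerivAt.comp_hasDerivAt t (hdp t)
      refine ((hasDerivAt_pow (ν + 1) t).mul (d2.sub d1)).congr_deriv ?_
      simp only [Nat.add_sub_cancel, Pi.sub_apply, Function.comp_apply]
      push_cast
      linear_combination t ^ ν * (h2 - h1 - hs)
    have hconst := constant_of_has_deriv_right_zero
      (fun t ht => (hder t ht).continuousAt.continuousWithinAt)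
      (fun t ht => (hder t ⟨ht.1, ht.2.le⟩).hasDerivWithinAt) 1 (by simp)
    simp [hp, sub_eq_zero] at hconst
    exact hconst

end Huygens

theorem theorem2 (m : ℕ) (k : Fin (m + 1) → ℤ) (phase : Fin (m + 1) → ℝ)
    (hk : StrictMono k) (hk0 : k 0 = 0) (hphase : phase 0 = 0)
    (Ω : Set (EuclideanSpace ℝ (Fin 2))) (hΩ : IsOpen Ω)
    (hΩreg : Ω ⊆ Huygens.regularSet k phase) :
    ∃ U : ℕ → EuclideanSpace ℝ (Fin 2) → EuclideanSpace ℝ (Fin 2) → ℝ,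
      Huygens.IsHadamardCoefficients (Huygens.potential k phase) Ω U ∧
      (∀ U' : ℕ → EuclideanSpace ℝ (Fin 2) → EuclideanSpace ℝ (Fin 2) → ℝ,
        Huygens.IsHadamardCoefficients (Huygens.potential k phase) Ω U' →
          ∀ (ν : ℕ) (x ξ : EuclideanSpace ℝ (Fin 2)), segment ℝ ξ x ⊆ Ω →
            U' ν x ξ = U ν x ξ) ∧
      (∀ (ν : ℕ) (r ρ φ θ : ℝ), 0 < r → 0 < ρ →
        Huygens.polarPoint r φ ∈ Ω → Huygens.polarPoint ρ θ ∈ Ω →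
          U ν (Huygens.polarPoint r φ) (Huygens.polarPoint ρ θ) =
            (-2) ^ ν / (r * ρ) ^ ν *
              ∑ i, Huygens.coeff k i * Huygens.Psi k phase i φ * Huygens.Psi k phase i θ *
                Huygens.chebyshevDeriv (k i) ν (Real.cos (φ - θ))) ∧
      (∀ ν : ℕ, k (Fin.last m) < (ν : ℤ) → ∀ x ∈ Ω, ∀ ξ ∈ Ω, U ν x ξ = 0) := by
  have hU := Huygens.isHadamardCoefficients_hadamardCoeff hk hk0 hphase hΩreg
  exact ⟨Huygens.hadamardCoeff k phase, hU,
    fun U' hU' ν x ξ h => hU.eq_of_segment_subset hΩ hU' ν h,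
    fun ν r ρ φ θ hr hρ _ _ => Huygens.hadamardCoeff_polarPoint k phase ν hr hρ φ θ,
    fun ν hν x _ ξ _ => Huygens.hadamardCoeff_eq_zero phase hk hk0 hν x ξ⟩
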